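/- Let $d \geq 1$ and let $S = \{x \in \mathbb{R}^d : |x| = 1\}$ be the unit sphere. For $n \geq 1$ and $A \subseteq \mathbb{R}^n$, the Fourier dimension of $A$ is $$\dim_F(A) = \sup\Big\{0 \leq s \leq n : \sup_{\xi \in \mathbb{R}^n} |\widehat{\mu}(\xi)|^2 |\xi|^s < \infty \text{ for some } \mu \in \mathcal{M}(A)\Big\},$$ where $\mathcal{M}(A)$ is the set of all non-zero finite Borel measures on $\mathbb{R}^n$ with compact support contained in $A$, and $\widehat{\mu}(\xi) = \int e^{-2\pi i x \cdot \xi}\, d\mu(x)$. For $R \subseteq (0,\infty)$ put $RS = \{ r x : r \in R,\ x \in S \} \subseteq \mathbb{R}^d$. Then, for every non-empty compact set $R \subseteq (0,\infty)$ (with $\dim_F(R)$ computed in $\mathbb{R}$), we have $$\dim_F(RS) \geq \dim_F(R) + \dim_F(S) \qquad\text{and}\qquad \dim_F(RS) \geq \dim_F(R) + (d-1).$$ -/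

import Mathlib

open MeasureTheory Set
open scoped Pointwise

noncomputable section

/-- The Fourier transform `μ̂(ξ) = ∫ e^{-2πi⟨x, ξ⟩} dμ(x)` of a measure `μ`. -/
def measureFourier {E : Type*} [NormedAddCommGroup E] [InnerProductSpace ℝ E]
    [MeasurableSpace E] (μ : Measure E) (ξ : E) : ℂ :=
  ∫ x, Complex.exp (-2 * (Real.pi : ℂ) * Complex.I * ((inner ℝ x ξ : ℝ) : ℂ)) ∂μ

/-- The set `𝓜(A)` of all non-zero finite Borel measures whose (topological) support is compact and
contained in `A`. -/
def compactMeasuresOn {E : Type*} [NormedAddCommGroup E] [MeasurableSpace E]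
    (A : Set E) : Set (Measure E) :=
  {μ | IsFiniteMeasure μ ∧ μ ≠ 0 ∧ IsCompact μ.support ∧ μ.support ⊆ A}

/-- The Fourier dimension of a subset `A` of a `d`-dimensional Euclidean space: the supremum of all
`s ∈ [0, d]` for which some `μ ∈ 𝓜(A)` satisfies `sup_ξ |μ̂(ξ)|² |ξ|^s < ∞`. The set of such `s` is
bounded by `d`, and it contains `0` as soon as `A` is non-empty. -/
def fourierDim {E : Type*} [NormedAddCommGroup E] [InnerProductSpace ℝ E]
    [MeasurableSpace E] (A : Set E) : ℝ :=
  sSup {s : ℝ | 0 ≤ s ∧ s ≤ (Module.finrank ℝ E : ℝ) ∧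
    ∃ μ ∈ compactMeasuresOn A,
      BddAbove (range fun ξ : E => ‖measureFourier μ ξ‖ ^ 2 * ‖ξ‖ ^ s)}

end

/-! Write `d = n + 1` and let `σ` be the rotation invariant measure on the sphere. Stationary phase
gives `|ξ|^(n/2) σ̂(ξ) = A e^{2πi|ξ|} + B e^{-2πi|ξ|} + O(1/|ξ|)`. For `μ` on `R`, let `ν` be the
image of `r^(n/2) dμ(r) × σ` under `(r, x) ↦ r x`. The weight makes the powers of `r` cancel, so
`|ξ|^(n/2) ν̂(ξ) = A μ̂(-|ξ|) + B μ̂(|ξ|) + O(1/|ξ|)`. Decay of `μ̂` with exponent `s ≤ 1` thus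
becomes decay of `ν̂` with exponent `s + n`, which is the second inequality
(`bddAbove_measureFourier_sphericalExtension`).

The asymptotics come without explicit Bessel functions: rotation invariance yields a Bessel type
equation for the radial profile of `σ̂`, and a perturbation argument at infinity solves it up to
`O(1/x)` (`exists_bessel_asymptotics`).

The first inequality follows from the second once `dim_F(S) ≤ d - 1`. Decay with exponent `s < d`
gives `(μ × μ){|x - y| ≤ 2δ} ≲ δ^s`, while Cauchy–Schwarz on a shell of volume `O(δ)` shows that
every nonzero measure on the sphere has this quantity `≳ δ^(d-1)`. -/

/-! ### Asymptotics at infinity of a Bessel type equation -/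

lemma exists_limit_of_norm_deriv_le {E : Type*} [NormedAddCommGroup E] [NormedSpace ℝ E]
    [CompleteSpace E] {f f' : ℝ → E} {K : ℝ} (hK : 0 ≤ K)
    (hf : ∀ x, 1 ≤ x → HasDerivAt f (f' x) x) (hb : ∀ x, 1 ≤ x → ‖f' x‖ ≤ K / x ^ 2) :
    ∃ L : E, ∀ x, 1 ≤ x → ‖f x - L‖ ≤ K / x := by
  have key : ∀ a b, 1 ≤ a → a ≤ b → ‖f b - f a‖ ≤ K / a := by
    intro a b ha hab
    have h := image_norm_le_of_norm_deriv_right_le_deriv_boundary' (f := fun x => f x - f a)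
      (f' := f') (a := a) (b := b) (B := fun x => K / a - K / x) (B' := fun x => K / x ^ 2)
      (fun x hx => ((hf x (ha.trans hx.1)).sub_const _).continuousAt.continuousWithinAt)
      (fun x hx => ((hf x (ha.trans hx.1)).sub_const _).hasDerivWithinAt)
      (by simp)
      (fun x hx => by
        have : x ≠ 0 := by linarith [hx.1]
        exact (continuousAt_const.sub
          (continuousAt_const.div continuousAt_id this)).continuousWithinAt)
      (fun x hx => by
        have hx0 : x ≠ 0 := by linarith [hx.1]
        have h1 := (hasDerivAt_const x (K / a)).sub ((hasDerivAt_inv hx0).const_mul K)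
        have h2 : HasDerivAt (fun x => K / a - K / x) (K / x ^ 2) x := by
          refine h1.congr_deriv ?_
          ring
        exact h2.hasDerivWithinAt)
      (fun x hx => hb x (ha.trans hx.1)) (right_mem_Icc.2 hab)
    have : 0 ≤ K / b := div_nonneg hK (by linarith)
    linarith
  have hc : CauchySeq fun n : ℕ => f (n + 1) := by
    refine cauchySeq_of_le_tendsto_0' (fun n : ℕ => K / ((n : ℝ) + 1)) (fun n m hnm => ?_) ?_
    · rw [dist_comm, dist_eq_norm]
      exact key _ _ (by simp) (by simpa using hnm)
    · exact tendsto_const_div_atTop_nhds_zero_nat K |>.comp (Filter.tendsto_add_atTop_nat 1)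
        |>.congr (by simp)
  obtain ⟨L, hL⟩ := cauchySeq_tendsto_of_complete hc
  refine ⟨L, fun x hx => ?_⟩
  have h2 : Filter.Tendsto (fun n : ℕ => ‖f (n + 1) - f x‖) Filter.atTop (nhds ‖L - f x‖) :=
    (hL.sub_const _).norm
  rw [norm_sub_rev]
  refine le_of_tendsto h2 ?_
  obtain ⟨N, hN⟩ := exists_nat_ge x
  filter_upwards [Filter.eventually_ge_atTop N] with n hn
  refine key _ _ hx ?_
  have : (N : ℝ) ≤ n := by exact_mod_cast hn
  linarith

/-- Grönwall: the coefficient `K / x ^ 2` is integrable at infinity, so the exponential growth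
factor stays bounded. -/
lemma exists_bound_of_norm_deriv_le {E : Type*} [NormedAddCommGroup E] [NormedSpace ℝ E]
    {f f' : ℝ → E} {K : ℝ} (hf : ∀ x, 1 ≤ x → HasDerivAt f (f' x) x)
    (hb : ∀ x, 1 ≤ x → ‖f' x‖ ≤ K / x ^ 2 * ‖f x‖) :
    ∃ M : ℝ, 0 ≤ M ∧ ∀ x, 1 ≤ x → ‖f x‖ ≤ M := by
  -- The two `+ 1`s make `k > K` and `M > 0`, so the barrier `M e^{-k/y}` grows strictly faster than
  -- `f` can wherever they touch.
  set k := |K| + 1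
  set M := (‖f 1‖ + 1) * Real.exp k with hM
  refine ⟨M, by positivity, fun x hx => ?_⟩
  have hd : ∀ y : ℝ, 1 ≤ y → HasDerivAt (fun y => M * Real.exp (-(k / y)))
      (k / y ^ 2 * (M * Real.exp (-(k / y)))) y := by
    intro y hy
    have hy0 : y ≠ 0 := by linarith
    have h1 := (((hasDerivAt_inv hy0).const_mul k).neg.exp).const_mul M
    refine h1.congr_deriv ?_
    change M * (Real.exp (-(k * y⁻¹)) * -(k * -(y ^ 2)⁻¹)) = _
    rw [← div_eq_mul_inv]
    ring
  have h := image_norm_le_of_norm_deriv_right_lt_deriv_boundary' (f := f) (f' := f')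
      (a := 1) (b := x) (B := fun y => M * Real.exp (-(k / y)))
      (B' := fun y => k / y ^ 2 * (M * Real.exp (-(k / y))))
      (fun y hy => (hf y hy.1).continuousAt.continuousWithinAt)
      (fun y hy => (hf y hy.1).hasDerivWithinAt)
      (by
        rw [hM, mul_assoc, ← Real.exp_add]
        simp)
      (fun y hy => (hd y hy.1).continuousAt.continuousWithinAt)
      (fun y hy => (hd y hy.1).hasDerivWithinAt)
      (fun y hy hE => by
        refine (hb y hy.1).trans_lt ?_
        rw [hE]
        have hy0 : 0 < y := by linarith [hy.1]
        have : K < k := by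
          have := le_abs_self K
          simp only [k]
          linarith
        gcongr) (right_mem_Icc.2 hx)
  refine h.trans ?_
  have : 0 ≤ k / x := by positivity
  have : Real.exp (-(k / x)) ≤ 1 := Real.exp_le_one_iff.2 (by linarith)
  exact mul_le_of_le_one_right (by positivity) this

/-- The function `u' + c u`, multiplied by `e^{-cρ}`, where `u = ρ^m φ`. -/
lemma hasDerivAt_bessel_aux {φ φ' φ'' : ℝ → ℂ} {m : ℝ} {c : ℂ} {x : ℝ} (hx : 0 < x)
    (h1 : HasDerivAt φ (φ' x) x) (h2 : HasDerivAt φ' (φ'' x) x)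
    (hode : (x : ℂ) * (φ'' x - c ^ 2 * φ x) + 2 * m * φ' x = 0) :
    HasDerivAt (fun y : ℝ => ((y ^ m : ℝ) : ℂ) * Complex.exp (-c * y) *
        (φ' y + (m / y : ℝ) * φ y + c * φ y))
      (((x ^ m : ℝ) : ℂ) * Complex.exp (-c * x) * (((m * (m - 1) / x ^ 2 : ℝ) : ℂ) * φ x)) x := by
  have hx0 : (x : ℂ) ≠ 0 := by exact_mod_cast hx.ne'
  have e1 : HasDerivAt (fun y : ℝ => ((y ^ m : ℝ) : ℂ)) ((m / x * x ^ m : ℝ) : ℂ) x := by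
    have := (Real.hasDerivAt_rpow_const (x := x) (p := m) (Or.inl hx.ne')).ofReal_comp
    refine this.congr_deriv ?_
    rw [Real.rpow_sub_one hx.ne']
    congr 1
    ring
  have e2 : HasDerivAt (fun y : ℝ => Complex.exp (-c * y)) (Complex.exp (-c * x) * (-c)) x := by
    have := ((hasDerivAt_id (x : ℂ)).const_mul (-c)).cexp.comp_ofReal
    simpa using this
  have e3 : HasDerivAt (fun y : ℝ => ((m / y : ℝ) : ℂ)) ((-m / x ^ 2 : ℝ) : ℂ) x := by
    have := ((hasDerivAt_inv hx.ne').const_mul m).ofReal_comp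
    refine this.congr_deriv ?_
    congr 1
    ring
  have := (e1.mul e2).mul ((h2.add (e3.mul h1)).add (h1.const_mul c))
  refine this.congr_deriv ?_
  have h3 : φ'' x = c ^ 2 * φ x - 2 * m / x * φ' x := by
    field_simp
    linear_combination hode
  simp only [Pi.mul_apply, Pi.add_apply]
  rw [h3]
  push_cast
  field_simp
  ring

/-- For `u = x^m φ` the equation reads `u'' + ω² u = m(m-1) u / x²`, a perturbation of the harmonic
oscillator. With `c = iω`, the quantities `W (±c) = e^{∓cx}(u' ± c u)` would be constant for the
oscillator and here have derivative `O(|u| / x²)`. They determine `u`, so Grönwall bounds them, and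
they then converge at rate `1 / x`. -/
lemma exists_bessel_asymptotics {φ φ' φ'' : ℝ → ℂ} {m ω : ℝ} (hω : 0 < ω)
    (h1 : ∀ x, HasDerivAt φ (φ' x) x) (h2 : ∀ x, HasDerivAt φ' (φ'' x) x)
    (hode : ∀ x : ℝ, 0 < x → (x : ℂ) * (φ'' x + ω ^ 2 * φ x) + 2 * m * φ' x = 0) :
    ∃ (A B : ℂ) (C : ℝ), ∀ x : ℝ, 1 ≤ x →
      ‖((x ^ m : ℝ) : ℂ) * φ x - (A * Complex.exp (Complex.I * ω * x) +
        B * Complex.exp (-(Complex.I * ω * x)))‖ ≤ C / x := by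
  let W : ℂ → ℝ → ℂ := fun c y => ((y ^ m : ℝ) : ℂ) * Complex.exp (-c * y) *
        (φ' y + (m / y : ℝ) * φ y + c * φ y)
  let W' : ℂ → ℝ → ℂ := fun c x =>
    ((x ^ m : ℝ) : ℂ) * Complex.exp (-c * x) * (((m * (m - 1) / x ^ 2 : ℝ) : ℂ) * φ x)
  set c : ℂ := Complex.I * ω with hc
  have hc2 : c ^ 2 = -(ω : ℂ) ^ 2 := by rw [hc, mul_pow, Complex.I_sq]; ring
  have hc0 : c ≠ 0 := by
    simp [hc, hω.ne']
  have hWp : ∀ x, 1 ≤ x → HasDerivAt (W c) (W' c x) x := fun x hx =>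
    hasDerivAt_bessel_aux (by linarith) (h1 x) (h2 x) (by
      rw [hc2]; linear_combination hode x (by linarith))
  have hWm : ∀ x, 1 ≤ x → HasDerivAt (W (-c)) (W' (-c) x) x := fun x hx =>
    hasDerivAt_bessel_aux (by linarith) (h1 x) (h2 x) (by
      rw [neg_sq, hc2]; linear_combination hode x (by linarith))
  have hu : ∀ x : ℝ, ((x ^ m : ℝ) : ℂ) * φ x =
      (2 * c)⁻¹ * (W c x * Complex.exp (c * x) - W (-c) x * Complex.exp (-(c * x))) := by
    intro x
    have e : Complex.exp (-(c * x)) * Complex.exp (c * x) = 1 := by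
      rw [← Complex.exp_add]; simp
    simp only [W, neg_neg, neg_mul]
    field_simp
    linear_combination (-2 * ((x ^ m : ℝ) : ℂ) * φ x * c) * e
  have hnp : ∀ x : ℝ, ‖Complex.exp (c * x)‖ = 1 := fun x => by
    rw [hc, mul_assoc, mul_comm, ← Complex.ofReal_mul, Complex.norm_exp_ofReal_mul_I]
  have hnm : ∀ x : ℝ, ‖Complex.exp (-(c * x))‖ = 1 := fun x => by
    rw [Complex.exp_neg, norm_inv, hnp, inv_one]
  have hc' : ‖(2 * c)⁻¹‖ = (2 * ω)⁻¹ := by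
    rw [hc]
    simp [abs_of_pos hω]
  have hub : ∀ x, ‖((x ^ m : ℝ) : ℂ) * φ x‖ ≤ (2 * ω)⁻¹ * (‖W c x‖ + ‖W (-c) x‖) := by
    intro x
    rw [hu, norm_mul, hc']
    gcongr
    refine (norm_sub_le _ _).trans ?_
    rw [norm_mul (W c x), norm_mul (W (-c) x), hnp, hnm, mul_one, mul_one]
  set k := |m * (m - 1)| with hk
  have hW' : ∀ s : ℂ, s = c ∨ s = -c → ∀ x : ℝ, ‖W' s x‖ =
      k / x ^ 2 * ‖((x ^ m : ℝ) : ℂ) * φ x‖ := by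
    intro s hs x
    have : ‖Complex.exp (-s * x)‖ = 1 := by
      rcases hs with rfl | rfl
      · rw [neg_mul]; exact hnm x
      · rw [neg_neg]; exact hnp x
    simp only [W', norm_mul, this, Complex.norm_real, norm_div, Real.norm_eq_abs, hk, abs_mul,
      abs_pow, sq_abs]
    ring
  -- Each derivative involves `u`, hence both `W`'s, so Grönwall is applied to the pair in the sup
  -- norm.
  obtain ⟨M, hM0, hM⟩ := exists_bound_of_norm_deriv_le (K := k * ω⁻¹)
    (f := fun x => (W c x, W (-c) x))
    (fun x hx => (hWp x hx).prodMk (hWm x hx)) (fun x hx => by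
      have hh : k / x ^ 2 * ‖((x ^ m : ℝ) : ℂ) * φ x‖ ≤
          k * ω⁻¹ / x ^ 2 * ‖(W c x, W (-c) x)‖ := by
        have e1 := norm_fst_le (W c x, W (-c) x)
        have e2 := norm_snd_le (W c x, W (-c) x)
        have e3 : ‖((x ^ m : ℝ) : ℂ) * φ x‖ ≤ ω⁻¹ * ‖(W c x, W (-c) x)‖ := by
          refine (hub x).trans ?_
          rw [mul_inv]
          have := inv_pos.2 hω
          simp only at e1 e2
          nlinarith
        calc _ ≤ k / x ^ 2 * (ω⁻¹ * ‖(W c x, W (-c) x)‖) := by gcongr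
          _ = _ := by ring
      rw [Prod.norm_def]
      refine max_le ?_ ?_
      · simp only [hW' c (Or.inl rfl) x]; exact hh
      · simp only [hW' (-c) (Or.inr rfl) x]; exact hh)
  have hbd : ∀ s : ℂ, s = c ∨ s = -c → ∀ x : ℝ, 1 ≤ x →
      ‖W' s x‖ ≤ k * ω⁻¹ * M / x ^ 2 := by
    intro s hs x hx
    rw [hW' s hs]
    have e1 := (norm_fst_le (W c x, W (-c) x)).trans (hM x hx)
    have e2 := (norm_snd_le (W c x, W (-c) x)).trans (hM x hx)
    have e3 : ‖((x ^ m : ℝ) : ℂ) * φ x‖ ≤ ω⁻¹ * M := by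
      refine (hub x).trans ?_
      rw [mul_inv]
      have := inv_pos.2 hω
      simp only at e1 e2
      nlinarith
    calc _ ≤ k / x ^ 2 * (ω⁻¹ * M) := by gcongr
      _ = _ := by ring
  have hK0 : 0 ≤ k * ω⁻¹ * M := by positivity
  obtain ⟨Lp, hLp⟩ := exists_limit_of_norm_deriv_le hK0 hWp (hbd c (Or.inl rfl))
  obtain ⟨Lm, hLm⟩ := exists_limit_of_norm_deriv_le hK0 hWm (hbd (-c) (Or.inr rfl))
  refine ⟨(2 * c)⁻¹ * Lp, -((2 * c)⁻¹ * Lm), ω⁻¹ * (k * ω⁻¹ * M), fun x hx => ?_⟩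
  rw [hu]
  have e : (2 * c)⁻¹ * (W c x * Complex.exp (c * x) - W (-c) x * Complex.exp (-(c * x))) -
      ((2 * c)⁻¹ * Lp * Complex.exp (c * x) + -((2 * c)⁻¹ * Lm) * Complex.exp (-(c * x))) =
      (2 * c)⁻¹ * ((W c x - Lp) * Complex.exp (c * x) -
        (W (-c) x - Lm) * Complex.exp (-(c * x))) := by ring
  rw [e, norm_mul, hc']
  have e4 := norm_sub_le ((W c x - Lp) * Complex.exp (c * x))
    ((W (-c) x - Lm) * Complex.exp (-(c * x)))
  rw [norm_mul, norm_mul, hnp, hnm, mul_one, mul_one] at e4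
  have e5 := hLp x hx
  have e6 := hLm x hx
  calc _ ≤ (2 * ω)⁻¹ * (k * ω⁻¹ * M / x + k * ω⁻¹ * M / x) := by
        gcongr
        linarith
    _ = _ := by field_simp; ring

lemma hasDerivAt_integral_of_ae_mem_isCompact {X : Type*} [TopologicalSpace X]
    [MeasurableSpace X] [BorelSpace X] [SecondCountableTopology X]
    {μ : Measure X} [IsFiniteMeasure μ]
    {K : Set X} (hK : IsCompact K) (hμ : ∀ᵐ x ∂μ, x ∈ K) {F F' : ℝ → X → ℂ}
    (hF : Continuous (Function.uncurry F)) (hF' : Continuous (Function.uncurry F'))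
    (hd : ∀ t x, HasDerivAt (fun s => F s x) (F' t x) t) (t : ℝ) :
    HasDerivAt (fun s => ∫ x, F s x ∂μ) (∫ x, F' t x ∂μ) t := by
  obtain ⟨C, hC⟩ := ((isCompact_Icc (a := t - 1) (b := t + 1)).prod hK).exists_bound_of_continuousOn
    hF'.continuousOn
  have hc : ∀ s, Continuous (F s) := fun s => hF.comp (by fun_prop : Continuous fun x => (s, x))
  have hc' : ∀ s, Continuous (F' s) := fun s => hF'.comp (by fun_prop : Continuous fun x => (s, x))
  obtain ⟨D, hD⟩ := hK.exists_bound_of_continuousOn (hc t).continuousOn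
  refine (hasDerivAt_integral_of_dominated_loc_of_deriv_le (bound := fun _ => C)
    (Icc_mem_nhds (by linarith : t - 1 < t) (by linarith : t < t + 1))
    (Filter.Eventually.of_forall fun s => (hc s).aestronglyMeasurable) ?_
    (hc' t).aestronglyMeasurable ?_ (integrable_const _) ?_).2
  · exact Integrable.of_bound (hc t).aestronglyMeasurable D (hμ.mono fun x hx => hD x hx)
  · exact hμ.mono fun x hx s hs => hC (s, x) ⟨hs, hx⟩
  · exact Filter.Eventually.of_forall fun x s _ => hd s x

/-! ### The rotation invariant measure on the sphere -/

section sphere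

variable {E : Type*} [NormedAddCommGroup E] [InnerProductSpace ℝ E] [FiniteDimensional ℝ E]
  [MeasurableSpace E] [BorelSpace E]

lemma measurable_normalize_vec : Measurable fun x : E => ‖x‖⁻¹ • x :=
  measurable_norm.inv.smul measurable_id

variable (E) in
/-- A rotation invariant finite measure on the unit sphere: the image of the volume on the unit
ball under `x ↦ x / ‖x‖`. -/
noncomputable def unitSphereMeasure : Measure E :=
  (volume.restrict (Metric.ball (0 : E) 1)).map fun x => ‖x‖⁻¹ • x

instance : IsFiniteMeasure (unitSphereMeasure E) := by
  have : IsFiniteMeasure (volume.restrict (Metric.ball (0 : E) 1)) :=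
    ⟨by simpa using measure_ball_lt_top⟩
  unfold unitSphereMeasure
  infer_instance

lemma unitSphereMeasure_univ_ne_zero : unitSphereMeasure E univ ≠ 0 := by
  rw [unitSphereMeasure, Measure.map_apply measurable_normalize_vec MeasurableSet.univ]
  simpa using (Metric.measure_ball_pos volume (0 : E) one_pos).ne'

lemma ae_norm_eq_one_unitSphereMeasure [Nontrivial E] :
    ∀ᵐ x ∂unitSphereMeasure E, x ∈ Metric.sphere (0 : E) 1 := by
  refine (ae_map_iff measurable_normalize_vec.aemeasurable
    (p := fun x => x ∈ Metric.sphere (0 : E) 1) Metric.isClosed_sphere.measurableSet).2 ?_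
  refine ae_restrict_of_ae ?_
  have : ∀ᵐ x : E, x ≠ 0 := by
    rw [ae_iff]
    simp
  filter_upwards [this] with x hx
  simp [norm_smul, hx]

lemma measurePreserving_unitSphereMeasure (L : E ≃ₗᵢ[ℝ] E) :
    MeasurePreserving L (unitSphereMeasure E) (unitSphereMeasure E) := by
  refine ⟨L.continuous.measurable, ?_⟩
  have h : (volume.restrict (Metric.ball (0 : E) 1)).map L =
      volume.restrict (Metric.ball (0 : E) 1) := by
    have := (L.measurePreserving.restrict_preimage
      (Metric.isOpen_ball (x := (0 : E)) (ε := 1)).measurableSet).map_eq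
    rwa [LinearIsometryEquiv.preimage_ball, map_zero] at this
  conv_rhs => rw [unitSphereMeasure, ← h]
  rw [unitSphereMeasure, Measure.map_map L.continuous.measurable measurable_normalize_vec,
    Measure.map_map measurable_normalize_vec L.continuous.measurable]
  congr 1
  ext x
  simp

lemma measureFourier_unitSphereMeasure_eq {v w : E} (h : ‖v‖ = ‖w‖) :
    measureFourier (unitSphereMeasure E) v = measureFourier (unitSphereMeasure E) w := by
  -- Reflection in the hyperplane bisecting `v` and `w` carries one to the other.
  let L := (ℝ ∙ (v - w))ᗮ.reflection
  have hL : L v = w := Submodule.reflection_sub h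
  unfold measureFourier
  symm
  rw [← hL, ← (measurePreserving_unitSphereMeasure L).integral_comp
    L.toHomeomorph.measurableEmbedding]
  simp only [LinearIsometryEquiv.inner_map_map]

end sphere

/-! ### The radial equation and the asymptotics of `σ̂` -/

section ode

variable {n : ℕ}

local notation "𝔼" => EuclideanSpace ℝ (Fin (n + 1))

/-- Turn `ρ e₀` towards `e_{i+1}` through the angle `t`: by invariance the transform is constant
along this circle, and the integral is its second derivative at `t = 0`. -/
lemma integral_second_rotation (c : ℂ) (ρ : ℝ) (i : Fin n)
    (hrot : ∀ v w : 𝔼, ‖v‖ = ‖w‖ →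
      ∫ x, Complex.exp (c * ((inner ℝ x v : ℝ) : ℂ)) ∂unitSphereMeasure 𝔼 =
      ∫ x, Complex.exp (c * ((inner ℝ x w : ℝ) : ℂ)) ∂unitSphereMeasure 𝔼) :
    ∫ x : 𝔼, (c * ρ * (-(x 0 : ℂ)) + (c * ρ * x i.succ) ^ 2) * Complex.exp (c * (ρ * x 0))
      ∂unitSphereMeasure 𝔼 = 0 := by
  let a : ℝ → 𝔼 → ℂ := fun t x => c * ρ * (Real.cos t * x 0 + Real.sin t * x i.succ)
  let a' : ℝ → 𝔼 → ℂ := fun t x => c * ρ * (-Real.sin t * x 0 + Real.cos t * x i.succ)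
  have ha : ∀ t x, HasDerivAt (fun s => a s x) (a' t x) t := by
    intro t x
    have h1 := (Real.hasDerivAt_cos t).ofReal_comp.mul_const (x 0 : ℂ)
    have h2 := (Real.hasDerivAt_sin t).ofReal_comp.mul_const (x i.succ : ℂ)
    refine ((h1.add h2).const_mul (c * ρ)).congr_deriv ?_
    simp [a']
  have ha' : ∀ t x, HasDerivAt (fun s => a' s x) (-a t x) t := by
    intro t x
    have h1 := (Real.hasDerivAt_sin t).neg.ofReal_comp.mul_const (x 0 : ℂ)
    have h2 := (Real.hasDerivAt_cos t).ofReal_comp.mul_const (x i.succ : ℂ)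
    have h3 := (h1.add h2).const_mul (c * ρ)
    refine (h3.congr_deriv ?_).congr_of_eventuallyEq (Filter.Eventually.of_forall fun s => ?_)
    · simp [a]; ring
    · simp [a']
  have hca : Continuous (Function.uncurry a) := by
    simp only [a, Function.uncurry_def]; fun_prop
  have hca' : Continuous (Function.uncurry a') := by
    simp only [a', Function.uncurry_def]; fun_prop
  have hK := isCompact_sphere (0 : 𝔼) 1
  have d1 := fun t => hasDerivAt_integral_of_ae_mem_isCompact hK ae_norm_eq_one_unitSphereMeasure
    (F := fun t x => Complex.exp (a t x)) (F' := fun t x => Complex.exp (a t x) * a' t x)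
    (Complex.continuous_exp.comp hca) ((Complex.continuous_exp.comp hca).mul hca')
    (fun t x => (ha t x).cexp) t
  have d2 := hasDerivAt_integral_of_ae_mem_isCompact hK ae_norm_eq_one_unitSphereMeasure
    (F := fun t x => Complex.exp (a t x) * a' t x)
    (F' := fun t x => Complex.exp (a t x) * a' t x * a' t x + Complex.exp (a t x) * -a t x)
    ((Complex.continuous_exp.comp hca).mul hca')
    ((((Complex.continuous_exp.comp hca).mul hca').mul hca').add
      ((Complex.continuous_exp.comp hca).mul hca.neg))
    (fun t x => (ha t x).cexp.mul (ha' t x)) 0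
  let γ : ℝ → 𝔼 := fun t => (ρ * Real.cos t) • EuclideanSpace.single 0 (1 : ℝ) +
    (ρ * Real.sin t) • EuclideanSpace.single i.succ (1 : ℝ)
  have hγ : ∀ t, ‖γ t‖ = ‖γ 0‖ := by
    have : ∀ t, ‖γ t‖ ^ 2 = ρ ^ 2 := by
      intro t
      have h0 : (0 : Fin (n + 1)) ≠ i.succ := (Fin.succ_ne_zero i).symm
      rw [EuclideanSpace.norm_sq_eq, Fin.sum_univ_succ, Finset.sum_eq_single i]
      · simp [γ, h0, h0.symm]
        rw [mul_pow, mul_pow, sq_abs, sq_abs, sq_abs, ← mul_add, Real.cos_sq_add_sin_sq, mul_one]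
      · intro j _ hj
        simp [γ, hj]
      · simp
    intro t
    rw [← sq_eq_sq₀ (norm_nonneg _) (norm_nonneg _), this, this]
  have hin : ∀ t x, c * ((inner ℝ x (γ t) : ℝ) : ℂ) = a t x := by
    intro t x
    simp [γ, a, inner_add_right, inner_smul_right, EuclideanSpace.inner_single_right]
    ring
  have hconst : ∀ t, ∫ x, Complex.exp (a t x) ∂unitSphereMeasure 𝔼 =
      ∫ x, Complex.exp (a 0 x) ∂unitSphereMeasure 𝔼 := by
    intro t
    simp_rw [← hin]
    exact hrot _ _ (hγ t)
  -- The first derivative vanishes for every `t`, not only at `0`, so it may be differentiated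
  -- again.
  have z1 : ∀ t, ∫ x, Complex.exp (a t x) * a' t x ∂unitSphereMeasure 𝔼 = 0 := by
    intro t
    refine (d1 t).unique ?_
    simp_rw [hconst]
    exact hasDerivAt_const _ _
  simp_rw [z1] at d2
  have z2 := d2.unique (hasDerivAt_const _ _)
  rw [← z2]
  congr 1
  ext x
  simp only [a, a', Real.cos_zero, Real.sin_zero, Complex.ofReal_one, Complex.ofReal_zero, one_mul,
    zero_mul, add_zero, zero_add, neg_zero]
  rw [mul_assoc c]
  ring_nf

/-- Summing the rotation identities over the `n` directions orthogonal to `e₀` and using `∑ x_{i+1}²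
= 1 - x₀²` on the sphere leaves an equation for the profile `φ` along `e₀`: the Bessel type equation
with `m = n / 2` and `ω = 2π`. -/
lemma exists_measureFourier_unitSphereMeasure_asymptotics :
    ∃ (A B : ℂ) (C : ℝ), ∀ ξ : 𝔼, 1 ≤ ‖ξ‖ →
      ‖((‖ξ‖ ^ ((n : ℝ) / 2) : ℝ) : ℂ) * measureFourier (unitSphereMeasure 𝔼) ξ -
        (A * Complex.exp (Complex.I * (2 * Real.pi : ℝ) * ‖ξ‖) +
        B * Complex.exp (-(Complex.I * (2 * Real.pi : ℝ) * ‖ξ‖)))‖ ≤ C / ‖ξ‖ := by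
  set c : ℂ := -2 * (Real.pi : ℂ) * Complex.I with hc
  let σ := unitSphereMeasure 𝔼
  let e : ℝ → 𝔼 → ℂ := fun t x => Complex.exp (c * (t * x 0))
  let φ : ℝ → ℂ := fun t => ∫ x, e t x ∂σ
  let φ' : ℝ → ℂ := fun t => ∫ x, c * x 0 * e t x ∂σ
  let φ'' : ℝ → ℂ := fun t => ∫ x, (c * x 0) ^ 2 * e t x ∂σ
  have hK := isCompact_sphere (0 : 𝔼) 1
  have hce : Continuous (Function.uncurry e) := by
    simp only [e, Function.uncurry_def]; fun_prop
  have hde : ∀ t x, HasDerivAt (fun s => e s x) (c * x 0 * e t x) t := by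
    intro t x
    have := (((hasDerivAt_id (t : ℂ)).mul_const (x 0 : ℂ)).const_mul c).cexp.comp_ofReal
    refine this.congr_deriv ?_
    simp [e]; ring
  have h1 : ∀ t, HasDerivAt φ (φ' t) t :=
    hasDerivAt_integral_of_ae_mem_isCompact hK ae_norm_eq_one_unitSphereMeasure hce
      (by simp only [e, Function.uncurry_def]; fun_prop) hde
  have h2 : ∀ t, HasDerivAt φ' (φ'' t) t :=
    hasDerivAt_integral_of_ae_mem_isCompact hK ae_norm_eq_one_unitSphereMeasure
      (F := fun t x => c * x 0 * e t x)
      (by simp only [e, Function.uncurry_def]; fun_prop)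
      (by simp only [e, Function.uncurry_def]; fun_prop)
      (fun t x => ((hde t x).const_mul (c * x 0)).congr_deriv (by ring))
  have hrot : ∀ v w : 𝔼, ‖v‖ = ‖w‖ →
      ∫ x, Complex.exp (c * ((inner ℝ x v : ℝ) : ℂ)) ∂σ =
      ∫ x, Complex.exp (c * ((inner ℝ x w : ℝ) : ℂ)) ∂σ :=
    fun v w h => measureFourier_unitSphereMeasure_eq h
  have hint : ∀ f : 𝔼 → ℂ, Continuous f → Integrable f σ := by
    intro f hf
    obtain ⟨D, hD⟩ := hK.exists_bound_of_continuousOn hf.continuousOn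
    exact Integrable.of_bound hf.aestronglyMeasurable D
      (ae_norm_eq_one_unitSphereMeasure.mono fun x hx => hD x hx)
  have hcet : ∀ t, Continuous (e t) := fun t => by simp only [e]; fun_prop
  have hode : ∀ t : ℝ, 0 < t → (t : ℂ) * (φ'' t + (2 * Real.pi : ℝ) ^ 2 * φ t) +
      2 * ((n : ℝ) / 2 : ℝ) * φ' t = 0 := by
    intro t ht
    have s1 : ∑ i : Fin n, ∫ x : 𝔼, (c * t * (-(x 0 : ℂ)) + (c * t * x i.succ) ^ 2) * e t x ∂σ = 0 :=
      Finset.sum_eq_zero fun i _ => integral_second_rotation c t i hrot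
    rw [← integral_finsetSum _ fun i _ => hint _ (by have := hcet t; fun_prop)] at s1
    have s2 : ∫ x : 𝔼, (-(n * t : ℂ) * (c * x 0 * e t x) +
        (c ^ 2 * t ^ 2 * e t x - (t : ℂ) ^ 2 * ((c * x 0) ^ 2 * e t x))) ∂σ = 0 := by
      rw [← s1]
      refine integral_congr_ae ?_
      filter_upwards [ae_norm_eq_one_unitSphereMeasure] with x hx
      have hx2 : ‖x‖ ^ 2 = 1 := by
        rw [mem_sphere_zero_iff_norm.1 hx, one_pow]
      rw [EuclideanSpace.norm_sq_eq, Fin.sum_univ_succ] at hx2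
      simp only [Real.norm_eq_abs, sq_abs] at hx2
      have hx3 : ∑ i : Fin n, ((x i.succ : ℝ) : ℂ) ^ 2 = 1 - (x 0 : ℂ) ^ 2 := by
        rw [eq_sub_iff_add_eq, add_comm]
        exact_mod_cast hx2
      rw [← Finset.sum_mul, Finset.sum_add_distrib]
      simp_rw [mul_pow _ ((x (Fin.succ _) : ℝ) : ℂ), ← Finset.mul_sum]
      rw [hx3]
      simp
      ring
    rw [integral_add (hint _ (by have := hcet t; fun_prop)) (hint _ (by have := hcet t; fun_prop)),
      integral_sub (hint _ (by have := hcet t; fun_prop)) (hint _ (by have := hcet t; fun_prop)),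
      integral_const_mul, integral_const_mul, integral_const_mul] at s2
    change -(n * t : ℂ) * φ' t + (c ^ 2 * t ^ 2 * φ t - (t : ℂ) ^ 2 * φ'' t) = 0 at s2
    have hc2 : c ^ 2 = -(2 * Real.pi : ℂ) ^ 2 := by
      rw [hc, mul_pow, Complex.I_sq]; ring
    rw [hc2] at s2
    have ht0 : (t : ℂ) ≠ 0 := by exact_mod_cast ht.ne'
    apply mul_left_cancel₀ ht0
    push_cast
    linear_combination -s2
  obtain ⟨A, B, C, h⟩ := exists_bessel_asymptotics (m := (n : ℝ) / 2) (ω := 2 * Real.pi)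
    (by positivity) h1 h2 hode
  refine ⟨A, B, C, fun ξ hξ => ?_⟩
  have : measureFourier (unitSphereMeasure 𝔼) ξ = φ ‖ξ‖ := by
    rw [measureFourier_unitSphereMeasure_eq (w := ‖ξ‖ • EuclideanSpace.single 0 (1 : ℝ))
      (by simp [norm_smul])]
    simp [measureFourier, φ, e, hc, inner_smul_right, EuclideanSpace.inner_single_right, σ]
  rw [this]
  exact h _ hξ

end ode

/-! ### Elementary bounds on Fourier transforms -/

section decay

variable {E : Type*} [NormedAddCommGroup E] [InnerProductSpace ℝ E] [MeasurableSpace E]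

lemma norm_measureFourier_le (μ : Measure E) [IsFiniteMeasure μ] (ξ : E) :
    ‖measureFourier μ ξ‖ ≤ μ.real univ := by
  refine (norm_integral_le_of_norm_le_const (C := 1) (Filter.Eventually.of_forall fun x => ?_)).trans
    (by simp)
  rw [show -2 * (Real.pi : ℂ) * Complex.I * ((inner ℝ x ξ : ℝ) : ℂ) =
    ((-2 * Real.pi * inner ℝ x ξ : ℝ) : ℂ) * Complex.I by push_cast; ring,
    Complex.norm_exp_ofReal_mul_I]

lemma measureFourier_decay_mono (μ : Measure E) [IsFiniteMeasure μ] {s s' C : ℝ}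
    (hs' : 0 ≤ s') (hss : s' ≤ s) (hC : ∀ ξ, ‖measureFourier μ ξ‖ ^ 2 * ‖ξ‖ ^ s ≤ C) :
    ∀ ξ, ‖measureFourier μ ξ‖ ^ 2 * ‖ξ‖ ^ s' ≤ C + μ.real univ ^ 2 := by
  intro ξ
  have hC0 : 0 ≤ C := le_trans (by positivity) (hC ξ)
  rcases le_total 1 ‖ξ‖ with h | h
  · have : ‖ξ‖ ^ s' ≤ ‖ξ‖ ^ s := Real.rpow_le_rpow_of_exponent_le h hss
    calc _ ≤ ‖measureFourier μ ξ‖ ^ 2 * ‖ξ‖ ^ s := by gcongr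
      _ ≤ C := hC ξ
      _ ≤ _ := by linarith [sq_nonneg (μ.real univ)]
  · have h1 : ‖ξ‖ ^ s' ≤ 1 := Real.rpow_le_one (norm_nonneg _) h hs'
    have h2 := norm_measureFourier_le μ ξ
    calc _ ≤ μ.real univ ^ 2 * 1 := by gcongr
      _ ≤ _ := by linarith

end decay

/-! ### The sphere has Fourier dimension at most `d - 1` -/

section upper

variable {E : Type*} [NormedAddCommGroup E] [InnerProductSpace ℝ E] [FiniteDimensional ℝ E]
  [MeasurableSpace E] [BorelSpace E]

open Module

/-- Expand `|μ̂|²` as an integral over `μ × μ`, exchange the integrals, and use that the transform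
of a Gaussian is a Gaussian. -/
lemma integral_gaussian_mul_norm_measureFourier_sq (μ : Measure E) [IsFiniteMeasure μ] {b : ℝ}
    (hb : 0 < b) :
    ∫ v, Real.exp (-b * ‖v‖ ^ 2) * ‖measureFourier μ v‖ ^ 2 =
      (Real.pi / b) ^ ((finrank ℝ E : ℝ) / 2) *
        ∫ p, Real.exp (-Real.pi ^ 2 * ‖p.1 - p.2‖ ^ 2 / b) ∂μ.prod μ := by
  let G : E → E × E → ℂ := fun v p =>
    Complex.exp (-2 * (Real.pi : ℂ) * Complex.I * ((inner ℝ v p.2 : ℝ) : ℂ)) *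
      Complex.exp (-b * ‖v‖ ^ 2 + 2 * Real.pi * Complex.I * ((inner ℝ p.1 v : ℝ) : ℂ))
  have hGn : ∀ v p, ‖G v p‖ = Real.exp (-b * ‖v‖ ^ 2) * 1 := by
    intro v p
    simp only [G]
    rw [← Complex.exp_add, Complex.norm_exp, mul_one]
    congr 1
    simp [← Complex.ofReal_pow]
  have hgi : Integrable (fun v : E => Real.exp (-b * ‖v‖ ^ 2)) := by
    have := (GaussianFourier.integrable_cexp_neg_mul_sq_norm_add (V := E) (b := b)
      (by simpa using hb) 0 0).norm
    refine this.congr (Filter.Eventually.of_forall fun v => ?_)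
    simp [Complex.norm_exp, ← Complex.ofReal_pow]
  have hGi : Integrable (Function.uncurry G) (volume.prod (μ.prod μ)) := by
    have h1 := hgi.mul_prod (integrable_const (1 : ℝ) (μ := μ.prod μ))
    refine h1.mono' ?_ (Filter.Eventually.of_forall fun z => (hGn z.1 z.2).le)
    refine Continuous.aestronglyMeasurable ?_
    simp only [G, Function.uncurry_def]
    fun_prop
  have hswap := integral_integral_swap hGi
  have hl : ∀ v, ∫ p, G v p ∂μ.prod μ =
      ((Real.exp (-b * ‖v‖ ^ 2) * ‖measureFourier μ v‖ ^ 2 : ℝ) : ℂ) := by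
    intro v
    have h1 : ∀ p : E × E, G v p = Complex.exp (-b * ‖v‖ ^ 2) *
        ((starRingEnd ℂ) (Complex.exp (-2 * (Real.pi : ℂ) * Complex.I *
          ((inner ℝ p.1 v : ℝ) : ℂ))) *
        Complex.exp (-2 * (Real.pi : ℂ) * Complex.I * ((inner ℝ p.2 v : ℝ) : ℂ))) := by
      intro p
      simp only [G]
      rw [← Complex.exp_conj, ← Complex.exp_add, ← Complex.exp_add, ← Complex.exp_add,
        real_inner_comm p.2 v]
      have h2 : (starRingEnd ℂ) 2 = 2 := map_ofNat _ 2
      congr 1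
      simp only [map_mul, map_neg, h2, Complex.conj_ofReal, Complex.conj_I]
      ring
    simp_rw [h1]
    rw [integral_const_mul, integral_prod_mul (fun x => (starRingEnd ℂ) (Complex.exp
      (-2 * (Real.pi : ℂ) * Complex.I * ((inner ℝ x v : ℝ) : ℂ))))
      (fun x => Complex.exp (-2 * (Real.pi : ℂ) * Complex.I * ((inner ℝ x v : ℝ) : ℂ))),
      integral_conj]
    change _ * ((starRingEnd ℂ) (measureFourier μ v) * measureFourier μ v) = _
    rw [Complex.conj_mul']
    push_cast
    rfl
  have hr : ∀ p : E × E, ∫ v, G v p = (((Real.pi / b) ^ ((finrank ℝ E : ℝ) / 2) *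
      Real.exp (-Real.pi ^ 2 * ‖p.1 - p.2‖ ^ 2 / b) : ℝ) : ℂ) := by
    intro p
    have := fourier_gaussian_innerProductSpace' (V := E) (b := b) (by simpa using hb) p.1 p.2
    rw [Real.fourier_eq'] at this
    rw [Complex.ofReal_mul, Complex.ofReal_cpow (by positivity)]
    push_cast
    rw [← this]
    refine integral_congr_ae (Filter.Eventually.of_forall fun v => ?_)
    simp only [G, smul_eq_mul]
    congr 2
    push_cast
    ring
  simp_rw [hl, hr] at hswap
  rw [integral_complex_ofReal, integral_complex_ofReal, integral_const_mul] at hswap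
  exact_mod_cast hswap

lemma integrable_exp_neg_sq_mul_rpow_norm [Nontrivial E] {s : ℝ} (hs : s < finrank ℝ E) :
    Integrable fun v : E => Real.exp (-‖v‖ ^ 2) * ‖v‖ ^ (-s) := by
  rw [integrable_fun_norm_addHaar (E := E) volume (f := fun y => Real.exp (-y ^ 2) * y ^ (-s))]
  have h := integrableOn_rpow_mul_exp_neg_mul_sq one_pos
    (s := (finrank ℝ E : ℝ) - 1 - s) (by linarith)
  refine (integrableOn_congr_fun (fun y hy => ?_) measurableSet_Ioi).1 h
  have hy : 0 < y := hy
  have hd : 1 ≤ finrank ℝ E := finrank_pos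
  rw [sub_eq_add_neg _ s, Real.rpow_add hy, smul_eq_mul, ← Nat.cast_one, ← Nat.cast_sub hd,
    Real.rpow_natCast]
  simp
  ring

lemma integral_exp_mul_rpow_norm_scale {s r : ℝ} (hr : 0 < r) :
    ∫ v : E, Real.exp (-r ^ 2 * ‖v‖ ^ 2) * ‖v‖ ^ (-s) =
      r ^ (s - finrank ℝ E) * ∫ v : E, Real.exp (-‖v‖ ^ 2) * ‖v‖ ^ (-s) := by
  have h := Measure.integral_comp_smul_of_nonneg (volume : Measure E)
    (fun v => Real.exp (-‖v‖ ^ 2) * ‖v‖ ^ (-s)) r (hR := hr.le)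
  rw [Real.rpow_sub hr, Real.rpow_natCast, div_eq_mul_inv, mul_assoc, ← smul_eq_mul (a := (r ^ _)⁻¹),
    ← h, ← integral_const_mul]
  congr 1
  ext v
  rw [norm_smul, Real.norm_of_nonneg hr.le, Real.mul_rpow hr.le (norm_nonneg _), mul_pow,
    Real.rpow_neg hr.le]
  have : r ^ s ≠ 0 := (Real.rpow_pos_of_pos hr s).ne'
  field_simp

/-- Decay of the Fourier transform forces a Frostman type bound on pairs of close points. -/
lemma exists_measureReal_dist_le [Nontrivial E] (μ : Measure E) [IsFiniteMeasure μ] {s C : ℝ}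
    (hs : s < finrank ℝ E) (hC : ∀ ξ, ‖measureFourier μ ξ‖ ^ 2 * ‖ξ‖ ^ s ≤ C) :
    ∃ D : ℝ, ∀ δ : ℝ, 0 < δ →
      (μ.prod μ).real {p | dist p.1 p.2 ≤ 2 * δ} ≤ D * δ ^ s := by
  set d := finrank ℝ E
  set I := ∫ v : E, Real.exp (-‖v‖ ^ 2) * ‖v‖ ^ (-s)
  refine ⟨Real.exp 1 * ((4 * Real.pi) ^ ((d : ℝ) / 2) * (C * ((2 * Real.pi) ^ (s - d) * I))),
    fun δ hδ => ?_⟩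
  -- With this `r` the Gaussian `exp(-π²|x - y|² / r²)` is at least `e⁻¹` whenever `|x - y| ≤ 2δ`.
  set r := 2 * Real.pi * δ with hr
  have hr0 : 0 < r := by positivity
  have hpi := Real.pi_pos
  have hb : 0 < r ^ 2 := by positivity
  have h1 := integral_gaussian_mul_norm_measureFourier_sq μ hb
  have hset : MeasurableSet {p : E × E | dist p.1 p.2 ≤ 2 * δ} :=
    measurableSet_le (by fun_prop) (by fun_prop)
  have h2 : (μ.prod μ).real {p | dist p.1 p.2 ≤ 2 * δ} ≤ Real.exp 1 *
      ∫ p, Real.exp (-Real.pi ^ 2 * ‖p.1 - p.2‖ ^ 2 / r ^ 2) ∂μ.prod μ := by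
    rw [← integral_indicator_one hset, ← integral_const_mul]
    refine integral_mono ((integrable_const _).indicator hset) (Integrable.const_mul ?_ _) ?_
    · refine Integrable.of_bound (Continuous.aestronglyMeasurable (by fun_prop)) 1
        (Filter.Eventually.of_forall fun p => ?_)
      rw [Real.norm_of_nonneg (Real.exp_nonneg _), Real.exp_le_one_iff, neg_mul, neg_div]
      have : 0 ≤ Real.pi ^ 2 * ‖p.1 - p.2‖ ^ 2 / r ^ 2 := by positivity
      linarith
    · intro p
      simp only [indicator_apply]
      split_ifs with hp
      swap
      · exact (mul_pos (Real.exp_pos _) (Real.exp_pos _)).le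
      have hp : dist p.1 p.2 ≤ 2 * δ := hp
      rw [dist_eq_norm] at hp
      rw [← Real.exp_add, Pi.one_apply]
      apply Real.one_le_exp
      have : Real.pi ^ 2 * ‖p.1 - p.2‖ ^ 2 / r ^ 2 ≤ 1 := by
        rw [div_le_one hb, hr, ← mul_pow]
        refine pow_le_pow_left₀ (by positivity) ?_ 2
        nlinarith
      rw [neg_mul, neg_div]
      linarith
  have h3 : ∫ v, Real.exp (-r ^ 2 * ‖v‖ ^ 2) * ‖measureFourier μ v‖ ^ 2 ≤
      C * (r ^ (s - d) * I) := by
    rw [← integral_exp_mul_rpow_norm_scale hr0, ← integral_const_mul]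
    refine integral_mono_of_nonneg (Filter.Eventually.of_forall fun v => by positivity) ?_ ?_
    · refine Integrable.const_mul ?_ _
      have := ((integrable_exp_neg_sq_mul_rpow_norm (E := E) hs).comp_smul hr0.ne').const_mul (r ^ s)
      refine this.congr (Filter.Eventually.of_forall fun v => ?_)
      simp only
      rw [norm_smul, Real.norm_of_nonneg hr0.le, Real.mul_rpow hr0.le (norm_nonneg _), mul_pow,
        Real.rpow_neg hr0.le]
      have : r ^ s ≠ 0 := (Real.rpow_pos_of_pos hr0 s).ne'
      field_simp
    · have h0 : ∀ᵐ v : E, v ≠ 0 := by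
        rw [ae_iff]
        simp
      filter_upwards [h0] with v hv
      have hv : 0 < ‖v‖ := norm_pos_iff.2 hv
      have := hC v
      rw [← le_div_iff₀ (Real.rpow_pos_of_pos hv s), div_eq_mul_inv, ← Real.rpow_neg hv.le] at this
      calc _ ≤ Real.exp (-r ^ 2 * ‖v‖ ^ 2) * (C * ‖v‖ ^ (-s)) := by gcongr
        _ = _ := by ring
  rw [h1] at h3
  -- Inverts the Gaussian normalising factor: `(π / r²) · 4πδ² = 1`.
  have h4 : (Real.pi / r ^ 2) ^ ((d : ℝ) / 2) * ((4 * Real.pi) ^ ((d : ℝ) / 2) * δ ^ (d : ℝ)) = 1 := by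
    have : δ ^ (d : ℝ) = (δ ^ 2) ^ ((d : ℝ) / 2) := by
      rw [← Real.rpow_natCast δ 2, ← Real.rpow_mul hδ.le]
      congr 1
      push_cast
      ring
    rw [this, ← Real.mul_rpow (by positivity) (by positivity),
      ← Real.mul_rpow (by positivity) (by positivity)]
    rw [show Real.pi / r ^ 2 * (4 * Real.pi * δ ^ 2) = 1 by rw [hr]; field_simp; norm_num]
    simp
  set J := ∫ p, Real.exp (-Real.pi ^ 2 * ‖p.1 - p.2‖ ^ 2 / r ^ 2) ∂μ.prod μ
  have h5 : J ≤ (4 * Real.pi) ^ ((d : ℝ) / 2) * δ ^ (d : ℝ) * (C * (r ^ (s - d) * I)) := by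
    calc J = (4 * Real.pi) ^ ((d : ℝ) / 2) * δ ^ (d : ℝ) *
          ((Real.pi / r ^ 2) ^ ((d : ℝ) / 2) * J) := by
          linear_combination (-J) * h4
      _ ≤ _ := by gcongr
  have h6 : r ^ (s - d) * δ ^ (d : ℝ) = (2 * Real.pi) ^ (s - d) * δ ^ s := by
    rw [hr, Real.mul_rpow (by positivity) hδ.le, mul_assoc, ← Real.rpow_add hδ]
    simp
  calc _ ≤ Real.exp 1 * J := h2
    _ ≤ Real.exp 1 * ((4 * Real.pi) ^ ((d : ℝ) / 2) * δ ^ (d : ℝ) * (C * (r ^ (s - d) * I))) := by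
        gcongr
    _ = _ := by
        linear_combination (Real.exp 1 * (4 * Real.pi) ^ ((d : ℝ) / 2) * C * I) * h6

lemma ENNReal.two_mul_mul_le_add_sq {a b : ENNReal} (ha : a ≠ ⊤) (hb : b ≠ ⊤) :
    2 * a * b ≤ a ^ 2 + b ^ 2 := by
  lift a to NNReal using ha
  lift b to NNReal using hb
  norm_cast
  exact two_mul_le_add_sq a b

lemma measure_shell_le [Nontrivial E] {δ : ℝ} (h0 : 0 < δ) (h1 : δ ≤ 1) :
    volume (Metric.closedBall (0 : E) (1 + δ) \ Metric.ball 0 (1 - δ)) ≤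
      ENNReal.ofReal (2 * finrank ℝ E * 2 ^ finrank ℝ E * δ) * volume (Metric.ball (0 : E) 1) := by
  set d := finrank ℝ E
  have hsub : Metric.ball (0 : E) (1 - δ) ⊆ Metric.closedBall 0 (1 + δ) :=
    Metric.ball_subset_closedBall.trans (Metric.closedBall_subset_closedBall (by linarith))
  rw [measure_sdiff hsub Metric.isOpen_ball.measurableSet.nullMeasurableSet
    measure_ball_lt_top.ne, Measure.addHaar_closedBall _ _ (by linarith),
    Measure.addHaar_ball _ _ (show 0 ≤ 1 - δ by linarith), ← ENNReal.sub_mul fun _ _ => measure_ball_lt_top.ne,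
    ← ENNReal.ofReal_sub _ (by have : 0 ≤ 1 - δ := by linarith
                               positivity)]
  gcongr
  have h := abs_pow_sub_pow_le (1 + δ) (1 - δ) d
  have e1 : |1 + δ - (1 - δ)| = 2 * δ := by
    rw [show 1 + δ - (1 - δ) = 2 * δ by ring, abs_of_pos (by linarith)]
  have e2 : max |1 + δ| |1 - δ| ≤ 2 := by
    refine max_le ?_ ?_ <;> rw [abs_le] <;> constructor <;> linarith
  have e3 : max |1 + δ| |1 - δ| ^ (d - 1) ≤ 2 ^ d :=
    (pow_le_pow_left₀ (by positivity) e2 _).trans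
      (pow_le_pow_right₀ (by norm_num) (Nat.sub_le _ _))
  rw [e1] at h
  calc _ ≤ _ := le_abs_self _
    _ ≤ _ := h
    _ ≤ 2 * δ * d * 2 ^ d := by gcongr
    _ = _ := by ring

/-- A measure on the unit sphere has many pairs of close points. -/
lemma le_measureReal_dist_le [Nontrivial E] (μ : Measure E) [IsFiniteMeasure μ]
    (hμ : ∀ᵐ x ∂μ, x ∈ Metric.sphere (0 : E) 1) {δ : ℝ} (h0 : 0 < δ) (h1 : δ ≤ 1) :
    (μ.real univ) ^ 2 / (2 * finrank ℝ E * 2 ^ finrank ℝ E) * δ ^ (finrank ℝ E - 1) ≤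
      (μ.prod μ).real {p | dist p.1 p.2 ≤ 2 * δ} := by
  set d := finrank ℝ E with hd
  have hdpos : 0 < d := finrank_pos
  set K : ℝ := 2 * d * 2 ^ d with hK
  have hK0 : 0 < K := by positivity
  set V := volume (Metric.ball (0 : E) 1) with hV
  have hV0 : V ≠ 0 := (Metric.measure_ball_pos volume (0 : E) one_pos).ne'
  have hVt : V ≠ ⊤ := measure_ball_lt_top.ne
  set A := Metric.closedBall (0 : E) (1 + δ) \ Metric.ball 0 (1 - δ) with hA
  have hAm : MeasurableSet A :=
    Metric.isClosed_closedBall.measurableSet.diff Metric.isOpen_ball.measurableSet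
  let f : E → ENNReal := fun x => μ (Metric.closedBall x δ)
  have hset : ∀ r : ℝ, MeasurableSet {p : E × E | dist p.1 p.2 ≤ r} := fun r =>
    measurableSet_le (by fun_prop) (by fun_prop)
  have hball : ∀ (r : ℝ) (x : E), Prod.mk x ⁻¹' {p : E × E | dist p.1 p.2 ≤ r} =
      Metric.closedBall x r := by
    intro r x
    ext y
    simp [dist_comm]
  have hball' : ∀ (r : ℝ) (y : E), (fun x => (x, y)) ⁻¹' {p : E × E | dist p.1 p.2 ≤ r} =
      Metric.closedBall y r := by
    intro r x
    ext y
    simp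
  have hfm : ∀ r, Measurable fun x => μ (Metric.closedBall x r) := by
    intro r
    have := measurable_measure_prodMk_left (ν := μ) (hset r)
    simpa only [hball] using this
  have hvol : ∀ x : E, volume (Metric.closedBall x δ) = ENNReal.ofReal (δ ^ d) * V := fun x =>
    Measure.addHaar_closedBall _ _ h0.le
  -- the total mass of `f`
  have hf1 : ∫⁻ x, f x = ENNReal.ofReal (δ ^ d) * V * μ univ := by
    have e1 := Measure.prod_apply (μ := (volume : Measure E)) (ν := μ) (hset δ)
    have e2 := Measure.prod_apply_symm (μ := (volume : Measure E)) (ν := μ) (hset δ)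
    rw [e1] at e2
    simp only [hball, hball', hvol, lintegral_const] at e2
    exact e2
  -- the square mass of `f`
  have hf2 : ∫⁻ x, f x ^ 2 ≤ ENNReal.ofReal (δ ^ d) * V *
      (μ.prod μ) {p | dist p.1 p.2 ≤ 2 * δ} := by
    -- One factor `f x` is written as an integral over `y` in the `δ`-ball at `x`; the other is at
    -- most `μ(B(y, 2δ))`, as that ball contains `B(x, δ)`. Integrating in `x` first then gives the
    -- volume of a `δ`-ball.
    have e1 : ∀ x, f x ^ 2 ≤ ∫⁻ y, {p : E × E | dist p.1 p.2 ≤ δ}.indicator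
        (fun p => μ (Metric.closedBall p.2 (2 * δ))) (x, y) ∂μ := by
      intro x
      have : f x ^ 2 = ∫⁻ y, (Metric.closedBall x δ).indicator (fun _ => f x) y ∂μ := by
        rw [lintegral_indicator_const Metric.isClosed_closedBall.measurableSet, sq]
      rw [this]
      refine lintegral_mono fun y => ?_
      by_cases hy : y ∈ Metric.closedBall x δ
      · have hy' : (x, y) ∈ {p : E × E | dist p.1 p.2 ≤ δ} := by
          rw [← hball] at hy; exact hy
        rw [indicator_of_mem hy, indicator_of_mem hy']
        refine measure_mono (Metric.closedBall_subset_closedBall' ?_)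
        have : dist x y ≤ δ := hy'
        linarith
      · rw [indicator_of_notMem hy]
        exact zero_le
    refine (lintegral_mono e1).trans ?_
    rw [lintegral_lintegral_swap]
    · have e2 : ∀ y, ∫⁻ x, {p : E × E | dist p.1 p.2 ≤ δ}.indicator
        (fun p => μ (Metric.closedBall p.2 (2 * δ))) (x, y) =
          ENNReal.ofReal (δ ^ d) * V * μ (Metric.closedBall y (2 * δ)) := by
        intro y
        have : ∀ x, {p : E × E | dist p.1 p.2 ≤ δ}.indicator
            (fun p => μ (Metric.closedBall p.2 (2 * δ))) (x, y) =
            (Metric.closedBall y δ).indicator (fun _ => μ (Metric.closedBall y (2 * δ))) x := by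
          intro x
          rw [← hball' δ y]
          rfl
        simp_rw [this]
        rw [lintegral_indicator_const Metric.isClosed_closedBall.measurableSet, hvol, mul_comm]
      simp_rw [e2]
      rw [lintegral_const_mul _ (hfm _), Measure.prod_apply (hset _)]
      simp only [hball]
      exact le_rfl
    · exact (((hfm (2 * δ)).comp measurable_snd).indicator (hset δ)).aemeasurable
  -- `f` vanishes off the shell
  have hfA : ∀ x, x ∉ A → f x = 0 := by
    intro x hx
    refine measure_mono_null (fun y hy => ?_) (ae_iff.1 hμ)
    intro hy1
    apply hx
    have hy1 : ‖y‖ = 1 := mem_sphere_zero_iff_norm.1 hy1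
    have hy : ‖y - x‖ ≤ δ := by rw [← dist_eq_norm]; exact hy
    have n1 := norm_sub_norm_le y x
    have n2 := norm_sub_norm_le x y
    rw [norm_sub_rev x y] at n2
    rw [hA]
    simp only [mem_sdiff, mem_closedBall_zero_iff, mem_ball_zero_iff, not_lt]
    constructor <;> linarith
  set M := μ.real univ with hM
  have hMu : μ univ = ENNReal.ofReal M := (ofReal_measureReal (measure_ne_top _ _)).symm
  set P := (μ.prod μ).real {p | dist p.1 p.2 ≤ 2 * δ} with hP
  have hPu : (μ.prod μ) {p | dist p.1 p.2 ≤ 2 * δ} = ENNReal.ofReal P :=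
    (ofReal_measureReal (measure_ne_top _ _)).symm
  -- Cauchy–Schwarz is used as `2 t f ≤ t² 1_A + f²`; this `t` maximises the resulting lower bound
  -- `2 t δ^d M - t² K δ`, up to the common factor `V`.
  set t : ℝ := δ ^ (d - 1) * M / K with ht
  have hM0 : 0 ≤ M := measureReal_nonneg
  have hP0 : 0 ≤ P := measureReal_nonneg
  have ht0 : 0 ≤ t := by positivity
  have main : 2 * ENNReal.ofReal t * ∫⁻ x, f x ≤ ENNReal.ofReal t ^ 2 * volume A + ∫⁻ x, f x ^ 2 := by
    rw [← lintegral_const_mul _ (hfm δ), ← lintegral_indicator_const hAm,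
      ← lintegral_add_left (measurable_const.indicator hAm)]
    refine lintegral_mono fun x => ?_
    by_cases hx : x ∈ A
    · rw [indicator_of_mem hx]
      exact ENNReal.two_mul_mul_le_add_sq ENNReal.ofReal_ne_top (measure_ne_top _ _)
    · have : μ (Metric.closedBall x δ) = 0 := hfA x hx
      simp [f, this]
  have main2 : 2 * ENNReal.ofReal t * (ENNReal.ofReal (δ ^ d) * V * ENNReal.ofReal M) ≤
      ENNReal.ofReal t ^ 2 * (ENNReal.ofReal (K * δ) * V) +
        ENNReal.ofReal (δ ^ d) * V * ENNReal.ofReal P := by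
    rw [← hMu, ← hPu, ← hf1]
    exact main.trans (add_le_add (by gcongr; exact measure_shell_le h0 h1) hf2)
  have main3 : 2 * t * (δ ^ d * M) ≤ t ^ 2 * (K * δ) + δ ^ d * P := by
    have e1 : ENNReal.ofReal (2 * t * (δ ^ d * M)) * V ≤
        ENNReal.ofReal (t ^ 2 * (K * δ) + δ ^ d * P) * V := by
      rw [ENNReal.ofReal_add (by positivity) (by positivity),
        ENNReal.ofReal_mul (p := 2 * t) (by positivity), ENNReal.ofReal_mul (p := 2) (by positivity),
        ENNReal.ofReal_mul (p := δ ^ d) (q := M) (by positivity),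
        ENNReal.ofReal_mul (p := δ ^ d) (q := P) (by positivity),
        ENNReal.ofReal_mul (p := t ^ 2) (by positivity),
        ENNReal.ofReal_pow ht0]
      have : ENNReal.ofReal 2 = 2 := by simp
      rw [this]
      convert main2 using 1 <;> ring
    rw [ENNReal.mul_le_mul_iff_left hV0 hVt] at e1
    exact (ENNReal.ofReal_le_ofReal_iff (by positivity)).1 e1
  have hδd : δ ^ d = δ ^ (d - 1) * δ := by
    rw [← pow_succ, Nat.sub_add_cancel hdpos]
  have e2 : δ ^ d * (M ^ 2 / K * δ ^ (d - 1)) ≤ δ ^ d * P := by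
    have : 2 * t * (δ ^ d * M) - t ^ 2 * (K * δ) = δ ^ d * (M ^ 2 / K * δ ^ (d - 1)) := by
      rw [ht, hδd]
      field_simp
      ring
    linarith
  exact le_of_mul_le_mul_left e2 (by positivity)

lemma le_finrank_sub_one_of_measureFourier_decay [Nontrivial E] (μ : Measure E) [IsFiniteMeasure μ]
    (hμ0 : μ ≠ 0) (hμ : ∀ᵐ x ∂μ, x ∈ Metric.sphere (0 : E) 1) {s C : ℝ}
    (hC : ∀ ξ, ‖measureFourier μ ξ‖ ^ 2 * ‖ξ‖ ^ s ≤ C) (hsd : s ≤ finrank ℝ E) :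
    s ≤ finrank ℝ E - 1 := by
  by_contra! hlt
  have hd : 1 ≤ finrank ℝ E := finrank_pos
  have hd' : (1 : ℝ) ≤ finrank ℝ E := by exact_mod_cast hd
  -- The midpoint is strictly below `d`, as the pair bound requires even when `s = d`, yet above `d
  -- - 1`, so that `c δ^(d-1) ≤ D δ^s'` fails as `δ → 0`.
  set s' := (s + (finrank ℝ E - 1)) / 2 with hs'
  obtain ⟨D, hD⟩ := exists_measureReal_dist_le μ (s := s') (by rw [hs']; linarith)
    (measureFourier_decay_mono μ (by rw [hs']; linarith) (by rw [hs']; linarith) hC)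
  set c := (μ.real univ) ^ 2 / (2 * finrank ℝ E * 2 ^ finrank ℝ E) with hc
  have hM : 0 < μ.real univ := by
    rw [measureReal_def, ENNReal.toReal_pos_iff]
    exact ⟨by simpa [pos_iff_ne_zero] using hμ0, measure_lt_top _ _⟩
  have hc0 : 0 < c := by positivity
  have key : ∀ δ : ℝ, 0 < δ → δ ≤ 1 → c ≤ D * δ ^ (s' - (finrank ℝ E - 1)) := by
    intro δ h0 h1
    have h := (le_measureReal_dist_le μ hμ h0 h1).trans (hD δ h0)
    rw [← hc, ← Real.rpow_natCast, Nat.cast_sub hd, Nat.cast_one] at h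
    rw [Real.rpow_sub h0, ← mul_div_assoc, le_div_iff₀ (by positivity)]
    exact h
  have hlim : Filter.Tendsto (fun δ : ℝ => D * δ ^ (s' - (finrank ℝ E - 1))) (nhdsWithin 0 (Ioi 0))
      (nhds (D * 0 ^ (s' - (finrank ℝ E - 1)))) := by
    refine Filter.Tendsto.mono_left ?_ nhdsWithin_le_nhds
    exact ((Real.continuous_rpow_const (by rw [hs']; linarith)).tendsto 0).const_mul D
  rw [Real.zero_rpow (by rw [hs']; intro h; linarith), mul_zero] at hlim
  have := ge_of_tendsto hlim (b := c) (by
    filter_upwards [Ioc_mem_nhdsGT (zero_lt_one' ℝ)] with δ hδ using key δ hδ.1 hδ.2)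
  linarith

end upper

/-! ### Spherical extension of a measure on `R`, and the dimension bounds -/

section spherical

variable {n : ℕ}

local notation "𝔼" => EuclideanSpace ℝ (Fin (n + 1))

variable (n) in
/-- The image under `(r, x) ↦ r x` of the product of `r ^ (n / 2) dμ(r)` with the invariant measure
on the unit sphere of an `n + 1`-dimensional Euclidean space. -/
noncomputable def sphericalExtension (μ : Measure ℝ) : Measure 𝔼 :=
  ((μ.withDensity fun r => ENNReal.ofReal (r ^ ((n : ℝ) / 2))).prod (unitSphereMeasure 𝔼)).map
    fun p => p.1 • p.2

lemma measurable_rpow_half : Measurable fun r : ℝ => r ^ ((n : ℝ) / 2) :=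
  (Real.continuous_rpow_const (by positivity)).measurable

lemma isFiniteMeasure_withDensity_rpow {μ : Measure ℝ} [IsFiniteMeasure μ] {R : Set ℝ}
    (hR : IsCompact R) (hμ : ∀ᵐ r ∂μ, r ∈ R) :
    IsFiniteMeasure (μ.withDensity fun r => ENNReal.ofReal (r ^ ((n : ℝ) / 2))) := by
  refine isFiniteMeasure_withDensity_ofReal (Integrable.hasFiniteIntegral ?_)
  have hc : Continuous fun r : ℝ => r ^ ((n : ℝ) / 2) :=
    Real.continuous_rpow_const (by positivity)
  obtain ⟨D, hD⟩ := hR.exists_bound_of_continuousOn hc.continuousOn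
  exact Integrable.of_bound hc.aestronglyMeasurable D (hμ.mono hD)

lemma sphericalExtension_mem_compactMeasuresOn {μ : Measure ℝ} {R : Set ℝ} (hR : IsCompact R)
    (hRpos : R ⊆ Ioi 0) (h : μ ∈ compactMeasuresOn R) :
    sphericalExtension n μ ∈ compactMeasuresOn (R • Metric.sphere (0 : 𝔼) 1) := by
  obtain ⟨hfin, hne, -, hsub⟩ := h
  have hae : ∀ᵐ r ∂μ, r ∈ R := Filter.mem_of_superset Measure.support_mem_ae hsub
  have := isFiniteMeasure_withDensity_rpow (n := n) hR hae
  have hm : Measurable fun p : ℝ × 𝔼 => p.1 • p.2 := measurable_fst.smul measurable_snd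
  have hK : IsCompact (R • Metric.sphere (0 : 𝔼) 1) := by
    rw [← image_smul_prod]
    exact (hR.prod (isCompact_sphere _ _)).image (by fun_prop)
  have hs : (sphericalExtension n μ).support ⊆ R • Metric.sphere (0 : 𝔼) 1 := by
    refine Measure.support_subset_of_isClosed hK.isClosed ?_
    refine (ae_map_iff hm.aemeasurable (p := fun x => x ∈ R • Metric.sphere (0 : 𝔼) 1)
      hK.isClosed.measurableSet).2 ?_
    have h1 := (withDensity_absolutelyContinuous μ
      fun r => ENNReal.ofReal (r ^ ((n : ℝ) / 2))).ae_le hae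
    filter_upwards [Measure.quasiMeasurePreserving_fst.ae h1,
      Measure.quasiMeasurePreserving_snd.ae ae_norm_eq_one_unitSphereMeasure] with p hp1 hp2
    exact smul_mem_smul hp1 hp2
  refine ⟨by unfold sphericalExtension; infer_instance, fun h0 => ?_,
    hK.of_isClosed_subset Measure.isClosed_support hs, hs⟩
  have h1 : sphericalExtension n μ univ = 0 := by rw [h0]; simp
  rw [sphericalExtension, Measure.map_apply hm MeasurableSet.univ, preimage_univ,
    Measure.prod_apply MeasurableSet.univ] at h1
  simp only [preimage_univ, lintegral_const] at h1
  rw [mul_eq_zero] at h1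
  replace h1 := Measure.measure_univ_eq_zero.1 (h1.resolve_left unitSphereMeasure_univ_ne_zero)
  -- The weight is positive on `R`, so `μ` is absolutely continuous with respect to the weighted
  -- measure and cannot survive if the latter is zero.
  refine hne (Measure.absolutelyContinuous_zero_iff.1 ?_)
  rw [← h1]
  refine withDensity_absolutelyContinuous' measurable_rpow_half.ennreal_ofReal.aemeasurable ?_
  filter_upwards [hae] with r hr
  have : 0 < r := hRpos hr
  simpa using Real.rpow_pos_of_pos this _

lemma measureFourier_sphericalExtension {μ : Measure ℝ} [IsFiniteMeasure μ] {R : Set ℝ}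
    (hR : IsCompact R) (hRpos : R ⊆ Ioi 0) (hae : ∀ᵐ r ∂μ, r ∈ R) (ξ : 𝔼) :
    measureFourier (sphericalExtension n μ) ξ =
      ∫ r, ((r ^ ((n : ℝ) / 2) : ℝ) : ℂ) * measureFourier (unitSphereMeasure 𝔼) (r • ξ) ∂μ := by
  have := isFiniteMeasure_withDensity_rpow (n := n) hR hae
  have hm : Measurable fun p : ℝ × 𝔼 => p.1 • p.2 := measurable_fst.smul measurable_snd
  rw [measureFourier, sphericalExtension, integral_map hm.aemeasurable
    (Continuous.aestronglyMeasurable (by fun_prop)), integral_prod]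
  · refine (integral_withDensity_eq_integral_smul
      (f := fun r : ℝ => Real.toNNReal (r ^ ((n : ℝ) / 2)))
      measurable_rpow_half.real_toNNReal _).trans ?_
    refine integral_congr_ae ?_
    filter_upwards [hae] with r hr
    have hr0 : 0 < r := hRpos hr
    simp only [measureFourier, real_inner_smul_left, real_inner_smul_right, NNReal.smul_def,
      Real.coe_toNNReal _ (Real.rpow_nonneg hr0.le _), Complex.real_smul]
  · refine Integrable.of_bound (Continuous.aestronglyMeasurable (by fun_prop)) 1
      (Filter.Eventually.of_forall fun p => ?_)
    rw [show -2 * (Real.pi : ℂ) * Complex.I * ((inner ℝ (p.1 • p.2) ξ : ℝ) : ℂ) =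
      ((-2 * Real.pi * inner ℝ (p.1 • p.2) ξ : ℝ) : ℂ) * Complex.I by push_cast; ring,
      Complex.norm_exp_ofReal_mul_I]

lemma continuous_measureFourier {E : Type*} [NormedAddCommGroup E] [InnerProductSpace ℝ E]
    [MeasurableSpace E] [BorelSpace E] [SecondCountableTopology E] (μ : Measure E)
    [IsFiniteMeasure μ] : Continuous (measureFourier μ) := by
  refine continuous_of_dominated (bound := fun _ => 1)
    (fun ξ => Continuous.aestronglyMeasurable (by fun_prop))
    (fun ξ => Filter.Eventually.of_forall fun x => ?_) (integrable_const _)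
    (Filter.Eventually.of_forall fun x => by fun_prop)
  rw [show -2 * (Real.pi : ℂ) * Complex.I * ((inner ℝ x ξ : ℝ) : ℂ) =
    ((-2 * Real.pi * inner ℝ x ξ : ℝ) : ℂ) * Complex.I by push_cast; ring,
    Complex.norm_exp_ofReal_mul_I]

lemma bddAbove_measureFourier_sphericalExtension {μ : Measure ℝ} {R : Set ℝ} (hR : IsCompact R)
    (hRne : R.Nonempty) (hRpos : R ⊆ Ioi 0) (h : μ ∈ compactMeasuresOn R) {s : ℝ} (hs0 : 0 ≤ s)
    (hs1 : s ≤ 1) (hdec : BddAbove (range fun ξ : ℝ => ‖measureFourier μ ξ‖ ^ 2 * ‖ξ‖ ^ s)) :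
    BddAbove (range fun ξ : 𝔼 =>
      ‖measureFourier (sphericalExtension n μ) ξ‖ ^ 2 * ‖ξ‖ ^ (s + n)) := by
  have hν := (sphericalExtension_mem_compactMeasuresOn (n := n) hR hRpos h).1
  obtain ⟨hfin, -, -, hsub⟩ := h
  have hae : ∀ᵐ r ∂μ, r ∈ R := Filter.mem_of_superset Measure.support_mem_ae hsub
  obtain ⟨D, hD⟩ := hdec
  have hD : ∀ t, ‖measureFourier μ t‖ ^ 2 * ‖t‖ ^ s ≤ D := fun t => hD ⟨t, rfl⟩
  obtain ⟨a, haR, hale⟩ := hR.exists_isLeast hRne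
  have ha : 0 < a := hRpos haR
  have hale : ∀ r ∈ R, a ≤ r := fun r hr => hale hr
  obtain ⟨A, B, C, hABC⟩ := exists_measureFourier_unitSphereMeasure_asymptotics (n := n)
  set M := μ.real univ with hM
  set N := (sphericalExtension n μ).real univ with hN
  -- For `|ξ| ≥ T` every `r ∈ R` has `r |ξ| ≥ a |ξ| ≥ 1`, so the asymptotics apply uniformly;
  -- smaller `ξ` only need the total mass bound.
  set T := max 1 (1 / a) with hT
  set m : ℝ := (n : ℝ) / 2 with hm
  have hC0 : 0 ≤ C := by
    have := (norm_nonneg _).trans (hABC (EuclideanSpace.single 0 (1 : ℝ)) (by simp))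
    simpa using this
  refine ⟨max (N ^ 2 * T ^ (s + n)) (3 * (‖A‖ ^ 2 * D + ‖B‖ ^ 2 * D + (C / a * M) ^ 2)), ?_⟩
  rintro _ ⟨ξ, rfl⟩
  simp only
  rcases le_total ‖ξ‖ T with hξ | hξ
  · refine le_max_of_le_left ?_
    have := norm_measureFourier_le (sphericalExtension n μ) ξ
    gcongr
  refine le_max_of_le_right ?_
  set t := ‖ξ‖ with ht
  have ht1 : 1 ≤ t := (le_max_left _ _).trans hξ
  have hat : 1 ≤ a * t := by
    have := (le_max_right _ _).trans hξ
    rwa [div_le_iff₀' ha] at this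
  have ht0 : 0 < t := by linarith
  let main : ℝ → ℂ := fun r => A * Complex.exp (Complex.I * (2 * Real.pi : ℝ) * (r * t : ℝ)) +
        B * Complex.exp (-(Complex.I * (2 * Real.pi : ℝ) * (r * t : ℝ)))
  let full : ℝ → ℂ := fun r => (((r * t) ^ m : ℝ) : ℂ) *
    measureFourier (unitSphereMeasure 𝔼) (r • ξ)
  have hfull : ((t ^ m : ℝ) : ℂ) * measureFourier (sphericalExtension n μ) ξ = ∫ r, full r ∂μ := by
    rw [measureFourier_sphericalExtension hR hRpos hae, ← integral_const_mul]
    refine integral_congr_ae ?_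
    filter_upwards [hae] with r hr
    have hr0 : 0 < r := hRpos hr
    simp only [full]
    rw [Real.mul_rpow hr0.le ht0.le]
    push_cast
    ring
  have hcm : Continuous main := by fun_prop
  have hcf : Continuous full := by
    have h1 : Continuous fun r : ℝ => (r * t) ^ m :=
      (Real.continuous_rpow_const (by positivity)).comp (by fun_prop)
    exact (Complex.continuous_ofReal.comp h1).mul
      ((continuous_measureFourier _).comp (by fun_prop))
  have hint : ∀ f : ℝ → ℂ, Continuous f → Integrable f μ := by
    intro f hf
    obtain ⟨L, hL⟩ := hR.exists_bound_of_continuousOn hf.continuousOn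
    exact Integrable.of_bound hf.aestronglyMeasurable L (hae.mono hL)
  -- The oscillating factors `e^{±2πirt}` are the characters defining `μ̂(∓t)`.
  have hmain : ∫ r, main r ∂μ = A * measureFourier μ (-t) + B * measureFourier μ t := by
    simp only [main]
    rw [integral_add (hint _ (by fun_prop)) (hint _ (by fun_prop)), integral_const_mul,
      integral_const_mul]
    unfold measureFourier
    congr 3 <;> ext r <;> congr 1 <;> simp <;> ring
  have herr : ‖∫ r, (full r - main r) ∂μ‖ ≤ C / (a * t) * M := by
    refine norm_integral_le_of_norm_le_const ?_
    filter_upwards [hae] with r hr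
    have hr0 : 0 < r := hRpos hr
    have hn : ‖r • ξ‖ = r * t := by rw [norm_smul, Real.norm_of_nonneg hr0.le]
    have hle : a * t ≤ r * t := by
      have := hale r hr
      gcongr
    have h1 := hABC (r • ξ) (by rw [hn]; linarith)
    rw [hn] at h1
    refine h1.trans ?_
    gcongr
  rw [integral_sub (hint _ hcf) (hint _ hcm), hmain, ← hfull] at herr
  set X := ((t ^ m : ℝ) : ℂ) * measureFourier (sphericalExtension n μ) ξ with hX
  have hXle : ‖X‖ ≤ ‖A‖ * ‖measureFourier μ (-t)‖ + ‖B‖ * ‖measureFourier μ t‖ +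
      C / (a * t) * M := by
    have e1 := norm_add_le (X - (A * measureFourier μ (-t) + B * measureFourier μ t))
      (A * measureFourier μ (-t) + B * measureFourier μ t)
    rw [sub_add_cancel] at e1
    have e2 := norm_add_le (A * measureFourier μ (-t)) (B * measureFourier μ t)
    rw [norm_mul, norm_mul] at e2
    linarith
  have hsq : ∀ x y z w : ℝ, 0 ≤ w → w ≤ x + y + z → w ^ 2 ≤ 3 * (x ^ 2 + y ^ 2 + z ^ 2) := by
    intro x y z w hw h
    have : w ^ 2 ≤ (x + y + z) ^ 2 := pow_le_pow_left₀ hw h 2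
    nlinarith [sq_nonneg (x - y), sq_nonneg (y - z), sq_nonneg (x - z)]
  have hX2 := hsq _ _ _ _ (norm_nonneg _) hXle
  have hXn : ‖X‖ ^ 2 = ‖measureFourier (sphericalExtension n μ) ξ‖ ^ 2 * t ^ (n : ℝ) := by
    rw [hX, norm_mul, Complex.norm_real, Real.norm_of_nonneg (by positivity), mul_pow,
      ← Real.rpow_natCast (t ^ m) 2, ← Real.rpow_mul ht0.le, mul_comm]
    congr 2
    rw [hm]
    push_cast
    ring
  have hd1 := hD (-t)
  have hd2 := hD t
  rw [norm_neg, Real.norm_of_nonneg ht0.le] at hd1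
  rw [Real.norm_of_nonneg ht0.le] at hd2
  -- The squared error is `O(t⁻²)`, which absorbs `t ^ s` because `s ≤ 1` and `t ≥ 1`.
  have hd3 : (C / (a * t) * M) ^ 2 * t ^ s ≤ (C / a * M) ^ 2 := by
    have e1 : t ^ s ≤ t ^ 2 := by
      rw [← Real.rpow_natCast]
      exact Real.rpow_le_rpow_of_exponent_le ht1 (by push_cast; linarith)
    calc _ ≤ (C / (a * t) * M) ^ 2 * t ^ 2 := by gcongr
      _ = _ := by field_simp
  calc _ = ‖X‖ ^ 2 * t ^ s := by
        rw [hXn, Real.rpow_add ht0]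
        ring
    _ ≤ 3 * ((‖A‖ * ‖measureFourier μ (-t)‖) ^ 2 + (‖B‖ * ‖measureFourier μ t‖) ^ 2 +
        (C / (a * t) * M) ^ 2) * t ^ s := by gcongr
    _ = 3 * (‖A‖ ^ 2 * (‖measureFourier μ (-t)‖ ^ 2 * t ^ s) +
        ‖B‖ ^ 2 * (‖measureFourier μ t‖ ^ 2 * t ^ s) + (C / (a * t) * M) ^ 2 * t ^ s) := by ring
    _ ≤ _ := by gcongr

lemma fourierDim_sphere_le :
    fourierDim (Metric.sphere (0 : 𝔼) 1) ≤ n := by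
  refine Real.sSup_le ?_ (by positivity)
  rintro s ⟨-, hs, μ, ⟨hfin, hne, -, hsub⟩, C, hC⟩
  have h := le_finrank_sub_one_of_measureFourier_decay μ hne
    (Filter.mem_of_superset Measure.support_mem_ae hsub) (fun ξ => hC ⟨ξ, rfl⟩) hs
  simpa using h

lemma fourierDim_add_le_fourierDim_smul_sphere {R : Set ℝ} (hR : R.Nonempty) (hRc : IsCompact R)
    (hRpos : R ⊆ Ioi 0) :
    fourierDim R + n ≤ fourierDim (R • Metric.sphere (0 : 𝔼) 1) := by
  rw [← le_sub_iff_add_le]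
  refine csSup_le ?_ ?_
  -- The supremum defining `fourierDim R` is over a nonempty set: a Dirac mass in `R` admits `s =
  -- 0`.
  · obtain ⟨r, hr⟩ := hR
    have hsupp : (Measure.dirac r).support ⊆ {r} :=
      Measure.support_subset_of_isClosed isClosed_singleton (by simp [ae_dirac_eq])
    refine ⟨0, le_rfl, by positivity, Measure.dirac r, ⟨inferInstance,
      IsProbabilityMeasure.ne_zero _, isCompact_singleton.of_isClosed_subset
        Measure.isClosed_support hsupp, hsupp.trans (by simpa using hr)⟩, 1, ?_⟩
    rintro _ ⟨ξ, rfl⟩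
    have h := norm_measureFourier_le (Measure.dirac r) ξ
    simp only [probReal_univ] at h
    simp only [Real.rpow_zero, mul_one]
    exact pow_le_one₀ (norm_nonneg _) h
  · rintro s ⟨hs0, hs1, μ, hμ, hdec⟩
    rw [Module.finrank_self, Nat.cast_one] at hs1
    rw [le_sub_iff_add_le]
    refine le_csSup ⟨Module.finrank ℝ 𝔼, fun x hx => hx.2.1⟩ ⟨by positivity, ?_,
      sphericalExtension n μ, sphericalExtension_mem_compactMeasuresOn hRc hRpos hμ,
      bddAbove_measureFourier_sphericalExtension hRc hR hRpos hμ hs0 hs1 hdec⟩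
    rw [finrank_euclideanSpace_fin]
    push_cast
    linarith

end spherical

theorem mainTheorem4 (d : ℕ) (hd : 1 ≤ d) (R : Set ℝ) (hR : R.Nonempty) (hRc : IsCompact R)
    (hRpos : R ⊆ Set.Ioi 0) :
    fourierDim R + fourierDim (Metric.sphere (0 : EuclideanSpace ℝ (Fin d)) 1) ≤
        fourierDim (R • Metric.sphere (0 : EuclideanSpace ℝ (Fin d)) 1) ∧
      fourierDim R + ((d : ℝ) - 1) ≤
        fourierDim (R • Metric.sphere (0 : EuclideanSpace ℝ (Fin d)) 1) := by
  obtain ⟨n, rfl⟩ := Nat.exists_eq_add_of_le' hd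
  have h := fourierDim_add_le_fourierDim_smul_sphere (n := n) hR hRc hRpos
  refine ⟨(add_le_add_right fourierDim_sphere_le _).trans h, ?_⟩
  push_cast
  rwa [add_sub_cancel_right]
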